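/- Let $n\ge 1$, let $U\subset\mathbb R^n$ be open and let $x:U\to\mathbb R^{n+1}$ be an injective $C^r$-immersion, $r\ge 3$, with $C^1$ unit normal field (Euclidean normalization) $\xi$ and Gaussian curvature $K=\det(h_{ij})/\det(g_{ij})\neq 0$ on $U$. Here $g_{ij}=\langle x_{/i},x_{/j}\rangle$, $h_{ij}=\langle \xi,x_{/ij}\rangle$, $e_{ij}=\langle\xi_{/i},\xi_{/j}\rangle$ are the first, second and third fundamental forms $I,II,III$, and $f_{/i}=\partial f/\partial u^i$. For a nondegenerate quadratic form $M=(M_{ij})$ with inverse $(M^{ij})$, a function $f$ and a vector-valued map $v$, put $\nabla^{M}(f,v)=M^{ij}f_{/i}v_{/j}$. A relative normalization of class $C^s$ ($1\le s<r$) is a $C^s$-map $y:U\to\mathbb R^{n+1}$ such that at every point $y\notin T_P$ and $y_{/i}\in T_P$ for all $i$, where $T_P$ is the span of the $x_{/i}$. Its support function is $q=\langle\xi,y\rangle$. Its covector $X$ is determined by $\langle X,x_{/i}\rangle=0$, $\langle X,y\rangle=1$, its relative metric is $G_{ij}=\langle X,x_{/ij}\rangle$, its Darboux tensor is $A_{ijk}=\langle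 X,\nabla^G_k\nabla^G_j x_{/i}\rangle$ (with $\nabla^G$ the Levi-Civita covariant derivative of $G$; the first term of $\nabla^G_k\nabla^G_jx_{/i}$, the derivative of $x_{/ij}-\Gamma^l_{ij}x_{/l}$, is expanded by the product rule, and its terms containing derivatives of $\Gamma^l_{ij}$ are tangential, so they do not contribute to $A_{ijk}$, which is therefore meaningful also for $r=3$), and its Tchebychev vector field is $T=\frac1n A_{ijk}G^{jk}G^{im}x_{/m}$. Let $T_{EUK}$ be the Tchebychev vector field of the relative normalization $\xi$, and put $Q=\frac{1}{2nq}\nabla^{III}(q,\xi)$. Then for every relative normalization $y$ the following hold on $U$: 1. $T=q\,T_{EUK}-q(n+2)\,Q$; 2. $T_{EUK}=\frac{1}{2nK}\nabla^{III}(K,\xi)$; 3. $y=q\,(2n\,Q+\xi)$, and the orthogonal projection of $y$ onto $T_P$ is $2nq\,Q$, so $Q$ is parallel to it; 4. $\frac1q\left[2n\,T+(n+2)\,y\right]=2n\,T_{EUK}+(n+2)\,\xi$; in particular the left-hand side is the same vector field for any two relative normalizations of $x$; 5. $T=\nabla^{G}(\ln\varphi,x)$ with $\varphi=|K|^{-\frac1{2n}}\,|q|^{\frac{n+2}{2n}}$;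 6. if $r\ge 4$, then $T$ is irrotational with respect to $G$: its covariant components $T_i=G_{im}T^m$ (where $T=T^mx_{/m}$) are differentiable and satisfy $\nabla^G_jT_i=\nabla^G_iT_j$. -/

import Mathlib

noncomputable section

namespace RelGeo

/-- The Euclidean space `ℝ^d` with its standard scalar product. -/
abbrev E (d : ℕ) : Type := EuclideanSpace ℝ (Fin d)

variable {n : ℕ} {F : Type*} [NormedAddCommGroup F] [NormedSpace ℝ F]

/-- The partial derivative `f_{/i} = ∂f/∂u^i`. -/
def pd (i : Fin n) (f : E n → F) (u : E n) : F :=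
  fderiv ℝ f u (EuclideanSpace.single i 1)

/-- The tangent vector space of `x` at the parameter `u`, spanned by the `x_{/i}(u)`. -/
def tangentSpace (x : E n → E (n + 1)) (u : E n) : Submodule ℝ (E (n + 1)) :=
  Submodule.span ℝ (Set.range fun i : Fin n => pd i x u)

/-- `x : U → ℝ^{n+1}` is an injective immersion of class `C^r` of the open set `U ⊆ ℝ^n`. -/
structure IsHypersurface (r : WithTop ℕ∞) (U : Set (E n)) (x : E n → E (n + 1)) : Prop where
  isOpen : IsOpen U
  injOn : Set.InjOn x U
  contDiffOn : ContDiffOn ℝ r x U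
  immersion : ∀ u ∈ U, LinearIndependent ℝ fun i : Fin n => pd i x u

/-- `y` is a relative `C^s`-normalization of `x`: `y ∉ T_P` and `y_{/i} ∈ T_P` at every point. -/
structure IsRelativeNormalization (s : WithTop ℕ∞) (U : Set (E n)) (x y : E n → E (n + 1)) :
    Prop where
  contDiffOn : ContDiffOn ℝ s y U
  transversal : ∀ u ∈ U, y u ∉ tangentSpace x u
  equitangent : ∀ u ∈ U, ∀ i : Fin n, pd i y u ∈ tangentSpace x u

/-- `ξ` is a Euclidean normalization of `x`: a (continuously differentiable) unit normal field. -/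
structure IsEuclideanNormalization (U : Set (E n)) (x ξ : E n → E (n + 1)) : Prop where
  contDiffOn : ContDiffOn ℝ 1 ξ U
  norm_eq_one : ∀ u ∈ U, ‖ξ u‖ = 1
  normal : ∀ u ∈ U, ∀ i : Fin n, inner ℝ (ξ u) (pd i x u) = 0

/-! Euclidean invariants -/

/-- First fundamental form `I`, `g_{ij} = ⟨x_{/i}, x_{/j}⟩`. -/
def formI (x : E n → E (n + 1)) (u : E n) : Matrix (Fin n) (Fin n) ℝ :=
  Matrix.of fun i j => inner ℝ (pd i x u) (pd j x u)

/-- Second fundamental form `II`, `h_{ij} = ⟨ξ, x_{/ij}⟩`. -/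
def formII (x ξ : E n → E (n + 1)) (u : E n) : Matrix (Fin n) (Fin n) ℝ :=
  Matrix.of fun i j => inner ℝ (ξ u) (pd j (pd i x) u)

/-- Third fundamental form `III`, `e_{ij} = ⟨ξ_{/i}, ξ_{/j}⟩`. -/
def formIII (ξ : E n → E (n + 1)) (u : E n) : Matrix (Fin n) (Fin n) ℝ :=
  Matrix.of fun i j => inner ℝ (pd i ξ u) (pd j ξ u)

/-- Gaussian curvature `K = det (h_{ij}) / det (g_{ij})`. -/
def gaussCurvature (x ξ : E n → E (n + 1)) (u : E n) : ℝ :=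
  (formII x ξ u).det / (formI x u).det

/-- First Beltrami differential operator `∇^M(f, v) = M^{ij} f_{/i} v_{/j}` of a nondegenerate
quadratic form `M`, for a function `f` and a (scalar or vector valued) `v`. -/
def beltrami (M : E n → Matrix (Fin n) (Fin n) ℝ) (f : E n → ℝ) (v : E n → F) (u : E n) : F :=
  ∑ i, ∑ j, ((M u)⁻¹ i j * pd i f u) • pd j v u

/-- Christoffel symbols `Γ^k_{ij}` of the Levi-Civita connection of `M`. -/
def christoffel (M : E n → Matrix (Fin n) (Fin n) ℝ) (k i j : Fin n) (u : E n) : ℝ :=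
  1 / 2 * ∑ l, (M u)⁻¹ k l *
    (pd i (fun w => M w j l) u + pd j (fun w => M w i l) u - pd l (fun w => M w i j) u)

/-- `∇^M_j v_{/i} = v_{/ij} - Γ^l_{ij} v_{/l}`. -/
def covDeriv₂ (M : E n → Matrix (Fin n) (Fin n) ℝ) (v : E n → F) (i j : Fin n) (u : E n) : F :=
  pd j (pd i v) u - ∑ l, christoffel M l i j u • pd l v u

/-- `∇^M_k ∇^M_j v_{/i}`. The leading term `∂_k (v_{/ij} - Γ^l_{ij} v_{/l})` is expanded by the
product rule; see `covDeriv₃_eq`. -/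
def covDeriv₃ (M : E n → Matrix (Fin n) (Fin n) ℝ) (v : E n → F) (i j k : Fin n) (u : E n) : F :=
  (pd k (pd j (pd i v)) u
      - ∑ l, (pd k (christoffel M l i j) u • pd l v u + christoffel M l i j u • pd k (pd l v) u))
    - ∑ m, christoffel M m k i u • covDeriv₂ M v m j u
    - ∑ m, christoffel M m k j u • covDeriv₂ M v i m u

/-- `covDeriv₃` is the covariant derivative of the tensor `∇^M_j v_{/i}`, wherever the latter is
differentiable term by term. -/
theorem covDeriv₃_eq (M : E n → Matrix (Fin n) (Fin n) ℝ) (v : E n → F) (i j k : Fin n) (u : E n)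
    (h1 : ∀ l, DifferentiableAt ℝ (pd l v) u) (h2 : DifferentiableAt ℝ (pd j (pd i v)) u)
    (h3 : ∀ l, DifferentiableAt ℝ (christoffel M l i j) u) :
    covDeriv₃ M v i j k u = pd k (covDeriv₂ M v i j) u
      - ∑ m, christoffel M m k i u • covDeriv₂ M v m j u
      - ∑ m, christoffel M m k j u • covDeriv₂ M v i m u := by
  have h4 : ∀ l ∈ Finset.univ, DifferentiableAt ℝ
      (fun w => christoffel M l i j w • pd l v w) u := fun l _ => (h3 l).smul (h1 l)
  have : pd k (covDeriv₂ M v i j) u = pd k (pd j (pd i v)) u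
      - ∑ l, (pd k (christoffel M l i j) u • pd l v u
        + christoffel M l i j u • pd k (pd l v) u) := by
    have h5 : covDeriv₂ M v i j
        = fun w => pd j (pd i v) w - ∑ l, christoffel M l i j w • pd l v w := rfl
    rw [h5]
    unfold pd at *
    rw [fderiv_fun_sub h2 (DifferentiableAt.fun_sum h4), fderiv_fun_sum h4]
    simp only [sub_apply, sum_apply]
    congr 1
    refine Finset.sum_congr rfl fun l _ => ?_
    rw [fderiv_fun_smul (h3 l) (h1 l)]
    simp [add_comm]
  rw [this, covDeriv₃]

/-! Relative invariants -/

/-- The covector `X` of the tangent hyperplane: with `ν` the component of `y` orthogonal to the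
tangent space, `X = ν / ‖ν‖²`. It is the unique vector with `⟨X, x_{/i}⟩ = 0` and `⟨X, y⟩ = 1`;
see `covector_unique`. -/
def covector (x y : E n → E (n + 1)) (u : E n) : E (n + 1) :=
  (‖(tangentSpace x u)ᗮ.starProjection (y u)‖ ^ 2)⁻¹ • (tangentSpace x u)ᗮ.starProjection (y u)

theorem covector_normal (x y : E n → E (n + 1)) (u : E n) (i : Fin n) :
    inner ℝ (covector x y u) (pd i x u) = 0 := by
  have h : covector x y u ∈ (tangentSpace x u)ᗮ :=
    Submodule.smul_mem _ _ (Submodule.starProjection_apply_mem _ _)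
  exact (Submodule.mem_orthogonal' _ _).1 h _ (Submodule.subset_span ⟨i, rfl⟩)

theorem covector_inner (x y : E n → E (n + 1)) (u : E n) (hy : y u ∉ tangentSpace x u) :
    inner ℝ (covector x y u) (y u) = 1 := by
  have h0 : (tangentSpace x u)ᗮ.starProjection (y u) ≠ 0 := by
    intro h
    rw [Submodule.starProjection_apply_eq_zero_iff, Submodule.orthogonal_orthogonal] at h
    exact hy h
  have h1 : inner ℝ ((tangentSpace x u)ᗮ.starProjection (y u)) (y u)
      = ‖(tangentSpace x u)ᗮ.starProjection (y u)‖ ^ 2 := by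
    have h2 := Submodule.inner_starProjection_left_eq_right (tangentSpace x u)ᗮ
      ((tangentSpace x u)ᗮ.starProjection (y u)) (y u)
    rw [← real_inner_self_eq_norm_sq, ← h2,
      Submodule.starProjection_eq_self_iff.2 (Submodule.starProjection_apply_mem _ _)]
  rw [covector, real_inner_smul_left, h1]
  exact inv_mul_cancel₀ (pow_ne_zero 2 (norm_ne_zero_iff.2 h0))

theorem covector_unique (x y : E n → E (n + 1)) (u : E n)
    (hx : LinearIndependent ℝ fun i : Fin n => pd i x u) (hy : y u ∉ tangentSpace x u)
    (X : E (n + 1)) (h1 : ∀ i : Fin n, inner ℝ X (pd i x u) = 0) (h2 : inner ℝ X (y u) = 1) :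
    X = covector x y u := by
  have hli : LinearIndependent ℝ (Fin.cons (y u) fun i : Fin n => pd i x u) :=
    linearIndependent_finCons.2 ⟨hx, hy⟩
  have htop := hli.span_eq_top_of_card_eq_finrank' (by simp)
  refine ext_inner_right ℝ fun w => ?_
  have hw : w ∈ Submodule.span ℝ (Set.range
      (Fin.cons (y u) fun i : Fin n => pd i x u : Fin (n + 1) → E (n + 1))) := by
    rw [htop]; trivial
  induction hw using Submodule.span_induction with
  | mem z hz =>
    obtain ⟨i, rfl⟩ := hz
    refine Fin.cases ?_ (fun i => ?_) i
    · simpa [covector_inner x y u hy] using h2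
    · simpa [covector_normal x y u i] using h1 i
  | zero => simp
  | add a b _ _ ha hb => rw [inner_add_right, inner_add_right, ha, hb]
  | smul c a _ ha => rw [inner_smul_right, inner_smul_right, ha]

/-- Relative metric `G_{ij} = ⟨X, x_{/ij}⟩`. -/
def relMetric (x y : E n → E (n + 1)) (u : E n) : Matrix (Fin n) (Fin n) ℝ :=
  Matrix.of fun i j => inner ℝ (covector x y u) (pd j (pd i x) u)

/-- Support function `q = ⟨ξ, y⟩`. -/
def support (ξ y : E n → E (n + 1)) (u : E n) : ℝ := inner ℝ (ξ u) (y u)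

/-- Darboux tensor `A_{ijk} = ⟨X, ∇^G_k ∇^G_j x_{/i}⟩`. -/
def darboux (x y : E n → E (n + 1)) (i j k : Fin n) (u : E n) : ℝ :=
  inner ℝ (covector x y u) (covDeriv₃ (relMetric x y) x i j k u)

/-- Components `T^m = (1/n) A_{ijk} G^{jk} G^{im}` of the Tchebychev vector field. -/
def tchebychevComp (x y : E n → E (n + 1)) (m : Fin n) (u : E n) : ℝ :=
  1 / (n : ℝ) * ∑ i, ∑ j, ∑ k,
    darboux x y i j k u * (relMetric x y u)⁻¹ j k * (relMetric x y u)⁻¹ i m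

/-- Tchebychev vector field `T = T^m x_{/m}` of the relative normalization `y`. -/
def tchebychev (x y : E n → E (n + 1)) (u : E n) : E (n + 1) :=
  ∑ m, tchebychevComp x y m u • pd m x u

/-- The tangent vector field `Q = (1/(2nq)) ∇^{III}(q, ξ)`. -/
def vectorQ (ξ y : E n → E (n + 1)) (u : E n) : E (n + 1) :=
  (1 / (2 * (n : ℝ) * support ξ y u)) • beltrami (formIII ξ) (support ξ y) ξ u

/-- The function `φ = |K|^{-1/(2n)} |q|^{(n+2)/(2n)}`. -/
def phi (x ξ y : E n → E (n + 1)) (u : E n) : ℝ :=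
  |gaussCurvature x ξ u| ^ (-1 / (2 * (n : ℝ)))
    * |support ξ y u| ^ (((n : ℝ) + 2) / (2 * (n : ℝ)))

/-- Covariant components `V_i = M_{im} V^m` of a tangent vector field with components `V^m`. -/
def lower (M : E n → Matrix (Fin n) (Fin n) ℝ) (V : Fin n → E n → ℝ) (i : Fin n) (u : E n) : ℝ :=
  ∑ m, M u i m * V m u

/-- The tangent vector field `V^m x_{/m}` is irrotational with respect to the metric `M` on `U`:
its covariant components are differentiable and `∇^M_j V_i = ∇^M_i V_j`. -/
def IsIrrotational (M : E n → Matrix (Fin n) (Fin n) ℝ) (U : Set (E n)) (V : Fin n → E n → ℝ) :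
    Prop :=
  (∀ i, DifferentiableOn ℝ (lower M V i) U) ∧
    ∀ u ∈ U, ∀ i j,
      pd j (lower M V i) u - ∑ k, christoffel M k i j u * lower M V k u
        = pd i (lower M V j) u - ∑ k, christoffel M k j i u * lower M V k u

end RelGeo

end

/-!
The theorem follows from one formula: the relative Tchebychev field is the gradient of `ln φ` with
respect to the relative metric.

The covector of a relative normalization `y` is `X = ξ / q` (`covector_eq`), hence `G = h / q`.
Pairing the second covariant derivatives of `x` with `X` kills every tangential term, and the
Christoffel symbols that remain occur only contracted with `G`, so the Darboux tensor is
`⟨X, x_{/ijk}⟩ - ½ (∂_i G_{jk} + ∂_j G_{ik} + ∂_k G_{ij})` (`darboux_eq_sub`). Inserting `G = h / q`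
and tracing with `G^{jk} = q h^{jk}` produces three kinds of terms: `h^{jk} ∂_i h_{jk}`, which is
`∂_i ln |det h|` by Jacobi's formula (`inv_det_mul_pd_det`); `h^{jk} ⟨ξ_{/j}, x_{/ik}⟩`, which is
`-½ ∂_i ln det g` by the Weingarten equations (`sum_inv_formII_mul_inner`); and multiples of
`∂_i q / q`. Together they give `A_{ijk} G^{jk} = -½ ∂_i ln |K| + ½ (n + 2) ∂_i ln |q|`
(`sum_darboux_mul_inv`), that is, `T = ∇^G(ln φ, x)` (`tchebychev_eq_beltrami`).

The Weingarten equations also give `III = II I⁻¹ II`, whence `∇^{III}(f, ξ) = -∇^{II}(f, x)`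
(`beltrami_formIII_normal`). This turns the gradient formula into the expressions for `T` and
`T_EUK` in terms of `K` and `Q`. The tangential part of `y` is read off from
`q_{/i} = ⟨ξ_{/i}, y⟩` (`sub_support_smul_eq`), and the invariance of `(2nT + (n + 2)y) / q` is then
linear algebra.

For the last claim, `T_i = ∂_i ln φ` and it remains to see that `ln φ` is `C²` when `x` is `C⁴`,
although `y` and `ξ` are only assumed to be `C¹`. The Weingarten equations express `ξ_{/i}` through
`h`, `g` and `x_{/k}`, so `ξ` is `C²` (`contDiffOn_normal_succ`); then `K` is `C²`, and
`q_{/i} = ⟨ξ_{/i}, y⟩` shows that `q` is `C²` as well (`contDiffOn_support`).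
-/

namespace RelGeo

open scoped Matrix

/-! ### Partial derivatives -/

section PartialDerivatives

variable {n : ℕ} {F : Type*} [NormedAddCommGroup F] [NormedSpace ℝ F]
  {U : Set (E n)} {u : E n} {m : WithTop ℕ∞}

theorem pd_congr (hU : IsOpen U) (hu : u ∈ U) {f g : E n → F} (h : ∀ w ∈ U, f w = g w)
    (i : Fin n) : pd i f u = pd i g u := by
  have h' : f =ᶠ[nhds u] g := Filter.eventuallyEq_of_mem (hU.mem_nhds hu) h
  rw [pd, pd, h'.fderiv_eq]

theorem contDiffOn_pd (hU : IsOpen U) {f : E n → F} (hf : ContDiffOn ℝ (m + 1) f U)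
    (i : Fin n) : ContDiffOn ℝ m (pd i f) U :=
  (hf.fderiv_of_isOpen hU le_rfl).clm_apply contDiffOn_const

/-- A differentiable map all of whose partial derivatives are `C^m` is `C^{m+1}`. -/
theorem contDiffOn_succ_of_pd (hU : IsOpen U) {k : ℕ} {f : E n → F} (hf : DifferentiableOn ℝ f U)
    (h : ∀ i, ContDiffOn ℝ k (pd i f) U) : ContDiffOn ℝ (k + 1) f U := by
  refine (contDiffOn_succ_iff_fderiv_of_isOpen hU).2
    ⟨hf, fun h => absurd h (by simp), contDiffOn_clm_apply.2 fun z => ?_⟩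
  have hz : z = ∑ i, z i • EuclideanSpace.single i (1 : ℝ) := by
    conv_lhs => rw [← (EuclideanSpace.basisFun (Fin n) ℝ).sum_repr z]
    simp
  have : (fun w => fderiv ℝ f w z) = fun w => ∑ i, z i • pd i f w := by
    funext w
    conv_lhs => rw [hz]
    simp [pd]
  rw [this]
  exact ContDiffOn.sum fun i _ => (h i).const_smul (z i)

theorem differentiableAt_of_contDiffOn (hU : IsOpen U) (hu : u ∈ U) {f : E n → F}
    (hm : 1 ≤ m) (hf : ContDiffOn ℝ m f U) : DifferentiableAt ℝ f u :=
  (hf.contDiffAt (hU.mem_nhds hu)).differentiableAt (by rintro rfl; simp at hm)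

theorem pd_comm (hU : IsOpen U) (hu : u ∈ U) {f : E n → F} (hf : ContDiffOn ℝ 2 f U)
    (i j : Fin n) : pd j (pd i f) u = pd i (pd j f) u := by
  have hd : DifferentiableAt ℝ (fderiv ℝ f) u :=
    differentiableAt_of_contDiffOn (m := 1) hU hu le_rfl
      (hf.fderiv_of_isOpen hU (by norm_num))
  have key : ∀ i j : Fin n, pd j (pd i f) u
      = fderiv ℝ (fderiv ℝ f) u (EuclideanSpace.single j 1) (EuclideanSpace.single i 1) := by
    intro i j
    have : pd i f = fun w => fderiv ℝ f w (EuclideanSpace.single i 1) := rfl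
    rw [this, pd, fderiv_clm_apply hd (differentiableAt_const _)]
    simp
  rw [key, key]
  exact ((hf.contDiffAt (hU.mem_nhds hu)).isSymmSndFDerivAt (by simp)) _ _

theorem pd_inner {d : ℕ} {f g : E n → E d} (hf : DifferentiableAt ℝ f u)
    (hg : DifferentiableAt ℝ g u) (i : Fin n) :
    pd i (fun w => inner ℝ (f w) (g w) : E n → ℝ) u
      = inner ℝ (f u) (pd i g u) + inner ℝ (pd i f u) (g u) :=
  fderiv_inner_apply ℝ hf hg _

theorem pd_inv_mul {f g : E n → ℝ} (hf : DifferentiableAt ℝ f u) (hg : DifferentiableAt ℝ g u)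
    (h0 : f u ≠ 0) (i : Fin n) :
    pd i (fun w => (f w)⁻¹ * g w) u = (f u)⁻¹ * pd i g u - (f u ^ 2)⁻¹ * pd i f u * g u := by
  have h := (((hasDerivAt_inv h0).comp_hasFDerivAt u hf.hasFDerivAt).mul hg.hasFDerivAt).fderiv
  simp only [pd]
  erw [h]
  simp
  ring

theorem pd_const_mul_log_add {f g : E n → ℝ} (hf : DifferentiableAt ℝ f u)
    (hg : DifferentiableAt ℝ g u) (hf0 : f u ≠ 0) (hg0 : g u ≠ 0) (a b : ℝ) (i : Fin n) :
    pd i (fun w => a * Real.log (f w) + b * Real.log (g w)) u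
      = a * (f u)⁻¹ * pd i f u + b * (g u)⁻¹ * pd i g u := by
  have h := (((hf.hasFDerivAt.log hf0).const_mul a).add
    ((hg.hasFDerivAt.log hg0).const_mul b)).fderiv
  simp only [pd]
  erw [h]
  simp
  ring

end PartialDerivatives

/-! ### Derivatives of determinants and inverse matrices -/

section Matrices

variable {n d : ℕ} {U : Set (E n)} {u : E n} {m : WithTop ℕ∞}

/-- Jacobi's formula for the derivative of a determinant. -/
theorem pd_det {M : E n → Matrix (Fin d) (Fin d) ℝ}
    (hM : ∀ j k, DifferentiableAt ℝ (fun w => M w j k) u) (i : Fin n) :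
    pd i (fun w => (M w).det) u
      = ∑ j, ∑ k, (M u).adjugate j k * pd i (fun w => M w k j) u := by
  have h1 : HasFDerivAt (fun w => (M w).det)
      (∑ σ : Equiv.Perm (Fin d), (Equiv.Perm.sign σ : ℝ) • ∑ j,
        (∏ k ∈ Finset.univ.erase j, M u (σ k) k) • fderiv ℝ (fun w => M w (σ j) j) u) u := by
    simp only [Matrix.det_apply']
    exact HasFDerivAt.fun_sum fun σ _ => (HasFDerivAt.finsetProd fun j _ =>
      (hM (σ j) j).hasFDerivAt).const_mul _
  have h2 : ∀ j, ∑ k, (M u).adjugate j k * pd i (fun w => M w k j) u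
      = ((M u).updateCol j fun k => pd i (fun w => M w k j) u).det := by
    intro j
    rw [← Matrix.cramer_apply, Matrix.cramer_eq_adjugate_mulVec]
    rfl
  rw [pd, h1.fderiv]
  simp only [h2, Matrix.det_apply']
  rw [Finset.sum_comm]
  simp only [sum_apply, smul_apply, smul_eq_mul, Finset.mul_sum]
  refine Finset.sum_congr rfl fun σ _ => Finset.sum_congr rfl fun j _ => ?_
  rw [← Finset.mul_prod_erase Finset.univ _ (Finset.mem_univ j), Matrix.updateCol_self,
    mul_comm (pd i _ u)]
  congr 2
  refine Finset.prod_congr rfl fun k hk => ?_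
  rw [Matrix.updateCol_ne (Finset.ne_of_mem_erase hk)]

/-- The logarithmic derivative of a determinant is `tr (M⁻¹ ∂M)`. -/
theorem inv_det_mul_pd_det {M : E n → Matrix (Fin d) (Fin d) ℝ}
    (hM : ∀ j k, DifferentiableAt ℝ (fun w => M w j k) u) (i : Fin n) :
    (M u).det⁻¹ * pd i (fun w => (M w).det) u
      = ∑ j, ∑ k, (M u)⁻¹ j k * pd i (fun w => M w k j) u := by
  rw [pd_det hM]
  simp [Matrix.inv_def, Finset.mul_sum, mul_assoc]

theorem contDiffOn_det {M : E n → Matrix (Fin d) (Fin d) ℝ}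
    (hM : ∀ j k, ContDiffOn ℝ m (fun w => M w j k) U) :
    ContDiffOn ℝ m (fun w => (M w).det) U := by
  simp only [Matrix.det_apply']
  exact ContDiffOn.sum fun σ _ => contDiffOn_const.mul (contDiffOn_prod fun j _ => hM _ _)

theorem contDiffOn_inv_apply {M : E n → Matrix (Fin d) (Fin d) ℝ}
    (hM : ∀ j k, ContDiffOn ℝ m (fun w => M w j k) U) (h0 : ∀ w ∈ U, (M w).det ≠ 0)
    (j k : Fin d) : ContDiffOn ℝ m (fun w => (M w)⁻¹ j k) U := by
  simp only [Matrix.inv_def, Matrix.smul_apply, Ring.inverse_eq_inv', smul_eq_mul,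
    Matrix.adjugate_apply]
  refine ((contDiffOn_det hM).inv h0).mul (contDiffOn_det fun a b => ?_)
  by_cases h : a = k
  · subst h
    simpa using contDiffOn_const
  · simpa [Matrix.updateRow_ne h] using hM a b

theorem sum_inv_mul_eq {M : Matrix (Fin d) (Fin d) ℝ} (h0 : M.det ≠ 0) (i k : Fin d) :
    ∑ j, M⁻¹ i j * M j k = (1 : Matrix (Fin d) (Fin d) ℝ) i k := by
  rw [← Matrix.mul_apply, Matrix.nonsing_inv_mul _ (isUnit_iff_ne_zero.2 h0)]

/-- The Christoffel symbols of the first kind, `M_{lk} Γ^k_{ij}`. -/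
theorem sum_mul_christoffel {M : E n → Matrix (Fin n) (Fin n) ℝ} (h0 : (M u).det ≠ 0)
    (i j l : Fin n) :
    ∑ k, M u l k * christoffel M k i j u
      = 1 / 2 * (pd i (fun w => M w j l) u + pd j (fun w => M w i l) u
          - pd l (fun w => M w i j) u) := by
  let c : Fin n → ℝ := fun l => 1 / 2 * (pd i (fun w => M w j l) u + pd j (fun w => M w i l) u
    - pd l (fun w => M w i j) u)
  have h1 : (fun k => christoffel M k i j u) = (M u)⁻¹ *ᵥ c := by
    funext k
    simp only [christoffel, Matrix.mulVec, dotProduct, c, Finset.mul_sum]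
    exact Finset.sum_congr rfl fun _ _ => by ring
  have h2 : M u *ᵥ (fun k => christoffel M k i j u) = c := by
    rw [h1, Matrix.mulVec_mulVec, Matrix.mul_nonsing_inv _ (isUnit_iff_ne_zero.2 h0),
      Matrix.one_mulVec]
  exact congrFun h2 l

theorem christoffel_comm {M : E n → Matrix (Fin n) (Fin n) ℝ} (hU : IsOpen U) (hu : u ∈ U)
    (hM : ∀ w ∈ U, ∀ i j, M w i j = M w j i) (k i j : Fin n) :
    christoffel M k i j u = christoffel M k j i u := by
  simp only [christoffel]
  congr 1
  refine Finset.sum_congr rfl fun l _ => ?_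
  rw [pd_congr hU hu (fun w hw => hM w hw i j) l]
  ring

variable {F : Type*} [NormedAddCommGroup F] [NormedSpace ℝ F]

theorem beltrami_of_pd_eq (M : E n → Matrix (Fin n) (Fin n) ℝ) {f g k : E n → ℝ} {a b : ℝ}
    (h : ∀ i, pd i f u = a * pd i g u + b * pd i k u) (v : E n → F) :
    beltrami M f v u = a • beltrami M g v u + b • beltrami M k v u := by
  simp only [beltrami, Finset.smul_sum, ← Finset.sum_add_distrib, smul_smul, ← add_smul, h]
  refine Finset.sum_congr rfl fun i _ => Finset.sum_congr rfl fun j _ => ?_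
  congr 1
  ring

end Matrices

/-! ### The Euclidean frame of a hypersurface -/

section EuclideanFrame

variable {n : ℕ} {U : Set (E n)} {x ξ y : E n → E (n + 1)} {u : E n} {r : WithTop ℕ∞}

theorem IsHypersurface.of_le {r' : WithTop ℕ∞} (hx : IsHypersurface r U x) (h : r' ≤ r) :
    IsHypersurface r' U x :=
  ⟨hx.isOpen, hx.injOn, hx.contDiffOn.of_le h, hx.immersion⟩

theorem IsRelativeNormalization.of_le {s s' : WithTop ℕ∞} (hy : IsRelativeNormalization s U x y)
    (h : s' ≤ s) : IsRelativeNormalization s' U x y :=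
  ⟨hy.contDiffOn.of_le h, hy.transversal, hy.equitangent⟩

theorem pd_mem_tangentSpace (x : E n → E (n + 1)) (u : E n) (i : Fin n) :
    pd i x u ∈ tangentSpace x u :=
  Submodule.subset_span ⟨i, rfl⟩

theorem exists_eq_sum_of_mem_tangentSpace {w : E (n + 1)} (hw : w ∈ tangentSpace x u) :
    ∃ a : Fin n → ℝ, w = ∑ i, a i • pd i x u := by
  obtain ⟨a, ha⟩ := (Submodule.mem_span_range_iff_exists_fun ℝ).1 hw
  exact ⟨a, ha.symm⟩

theorem eq_of_mem_tangentSpace_of_inner_eq {w w' : E (n + 1)} (hw : w ∈ tangentSpace x u)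
    (hw' : w' ∈ tangentSpace x u) (h : ∀ i, (inner ℝ w (pd i x u) : ℝ) = inner ℝ w' (pd i x u)) :
    w = w' := by
  have h1 : w - w' ∈ (tangentSpace x u)ᗮ := by
    refine (Submodule.mem_orthogonal' _ _).2 fun z hz => ?_
    obtain ⟨a, rfl⟩ := exists_eq_sum_of_mem_tangentSpace hz
    simp [inner_sum, inner_smul_right, inner_sub_left, h]
  have h2 := (Submodule.mem_orthogonal' _ _).1 h1 _ (Submodule.sub_mem _ hw hw')
  exact sub_eq_zero.1 (inner_self_eq_zero.1 h2)

theorem normal_mem_orthogonal (hξ : IsEuclideanNormalization U x ξ) (hu : u ∈ U) :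
    ξ u ∈ (tangentSpace x u)ᗮ := by
  refine (Submodule.mem_orthogonal' _ _).2 fun z hz => ?_
  obtain ⟨a, rfl⟩ := exists_eq_sum_of_mem_tangentSpace hz
  simp [inner_sum, inner_smul_right, hξ.normal u hu]

theorem inner_normal_self (hξ : IsEuclideanNormalization U x ξ) (hu : u ∈ U) :
    (inner ℝ (ξ u) (ξ u) : ℝ) = 1 := by
  rw [real_inner_self_eq_norm_sq, hξ.norm_eq_one u hu, one_pow]

theorem normal_not_mem_tangentSpace (hξ : IsEuclideanNormalization U x ξ) (hu : u ∈ U) :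
    ξ u ∉ tangentSpace x u := fun h => by
  have h1 := (Submodule.mem_orthogonal' _ _).1 (normal_mem_orthogonal hξ hu) _ h
  rw [inner_normal_self hξ hu] at h1
  exact one_ne_zero h1

/-- Since the tangent space has codimension one, everything orthogonal to `ξ` is tangential. -/
theorem mem_tangentSpace_of_inner_normal_eq_zero (hx : IsHypersurface r U x)
    (hξ : IsEuclideanNormalization U x ξ) (hu : u ∈ U) {w : E (n + 1)}
    (hw : (inner ℝ (ξ u) w : ℝ) = 0) : w ∈ tangentSpace x u := by
  have hli : LinearIndependent ℝ (Fin.cons (ξ u) fun i : Fin n => pd i x u) :=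
    linearIndependent_finCons.2 ⟨hx.immersion u hu, normal_not_mem_tangentSpace hξ hu⟩
  have htop := hli.span_eq_top_of_card_eq_finrank' (by simp)
  have hw' : w ∈ Submodule.span ℝ (Set.range
      (Fin.cons (ξ u) fun i : Fin n => pd i x u : Fin (n + 1) → E (n + 1))) := by
    rw [htop]; trivial
  rw [Fin.range_cons, Submodule.mem_span_insert] at hw'
  obtain ⟨a, z, hz, rfl⟩ := hw'
  have h0 : (inner ℝ (ξ u) z : ℝ) = 0 :=
    (Submodule.mem_orthogonal' _ _).1 (normal_mem_orthogonal hξ hu) z hz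
  rw [inner_add_right, inner_smul_right, inner_normal_self hξ hu, h0] at hw
  have ha : a = 0 := by linarith
  rw [ha, zero_smul, zero_add]
  exact hz

theorem differentiableAt_normal (hx : IsHypersurface r U x)
    (hξ : IsEuclideanNormalization U x ξ) (hu : u ∈ U) : DifferentiableAt ℝ ξ u :=
  differentiableAt_of_contDiffOn hx.isOpen hu le_rfl hξ.contDiffOn

theorem pd_normal_mem_tangentSpace (hx : IsHypersurface r U x)
    (hξ : IsEuclideanNormalization U x ξ) (hu : u ∈ U) (i : Fin n) :
    pd i ξ u ∈ tangentSpace x u := by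
  have hd := differentiableAt_normal hx hξ hu
  have h1 := pd_inner hd hd i
  rw [pd_congr hx.isOpen hu (g := fun _ => (1 : ℝ)) (fun w hw => inner_normal_self hξ hw) i,
    real_inner_comm (ξ u) (pd i ξ u)] at h1
  have h2 : pd i (fun _ : E n => (1 : ℝ)) u = 0 := by simp [pd]
  rw [h2] at h1
  refine mem_tangentSpace_of_inner_normal_eq_zero hx hξ hu (w := pd i ξ u) ?_
  linarith [real_inner_comm (ξ u) (pd i ξ u)]

theorem IsEuclideanNormalization.isRelativeNormalization (hx : IsHypersurface r U x)
    (hξ : IsEuclideanNormalization U x ξ) : IsRelativeNormalization 1 U x ξ :=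
  ⟨hξ.contDiffOn, fun _ hu => normal_not_mem_tangentSpace hξ hu,
    fun _ hu i => pd_normal_mem_tangentSpace hx hξ hu i⟩

theorem IsHypersurface.contDiffOn_pd {k : ℕ} (hx : IsHypersurface (k + 1) U x) (i : Fin n) :
    ContDiffOn ℝ k (pd i x) U :=
  RelGeo.contDiffOn_pd hx.isOpen hx.contDiffOn i

theorem IsHypersurface.contDiffOn_pd_pd {k : ℕ} (hx : IsHypersurface (k + 2) U x) (i j : Fin n) :
    ContDiffOn ℝ k (pd j (pd i x)) U := by
  refine RelGeo.contDiffOn_pd hx.isOpen (RelGeo.contDiffOn_pd hx.isOpen ?_ i) j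
  rw [add_assoc, one_add_one_eq_two]
  exact hx.contDiffOn

theorem formI_eq_gram (x : E n → E (n + 1)) (u : E n) :
    formI x u = Matrix.gram ℝ fun i => pd i x u := rfl

theorem det_formI_ne_zero (hx : IsHypersurface r U x) (hu : u ∈ U) : (formI x u).det ≠ 0 := by
  rw [formI_eq_gram]
  exact Matrix.det_gram_ne_zero_iff_linearIndependent.2 (hx.immersion u hu)

theorem det_formII_ne_zero (hK : gaussCurvature x ξ u ≠ 0) : (formII x ξ u).det ≠ 0 :=
  fun h => hK (by rw [gaussCurvature, h, zero_div])

theorem formI_transpose (x : E n → E (n + 1)) (u : E n) : (formI x u)ᵀ = formI x u := by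
  ext i j
  exact real_inner_comm (pd i x u) (pd j x u)

theorem formII_comm (hx : IsHypersurface 2 U x) (hu : u ∈ U) (i j : Fin n) :
    formII x ξ u i j = formII x ξ u j i := by
  simp only [formII, Matrix.of_apply, pd_comm hx.isOpen hu hx.contDiffOn i j]

theorem formII_transpose (hx : IsHypersurface 2 U x) (hu : u ∈ U) :
    (formII x ξ u)ᵀ = formII x ξ u := by
  ext i j
  exact formII_comm hx hu j i

theorem inv_formII_comm (hx : IsHypersurface 2 U x) (hu : u ∈ U) (i j : Fin n) :
    (formII x ξ u)⁻¹ i j = (formII x ξ u)⁻¹ j i := by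
  conv_lhs => rw [← formII_transpose hx hu, ← Matrix.transpose_nonsing_inv]
  rfl

theorem inv_formI_comm (x : E n → E (n + 1)) (u : E n) (i j : Fin n) :
    (formI x u)⁻¹ i j = (formI x u)⁻¹ j i := by
  conv_lhs => rw [← formI_transpose, ← Matrix.transpose_nonsing_inv]
  rfl

theorem contDiffOn_formI {k : ℕ} (hx : IsHypersurface (k + 1) U x) (i j : Fin n) :
    ContDiffOn ℝ k (fun w => formI x w i j) U :=
  (hx.contDiffOn_pd i).inner ℝ (hx.contDiffOn_pd j)

theorem contDiffOn_formII {k : ℕ} (hx : IsHypersurface (k + 2) U x) (hξ : ContDiffOn ℝ k ξ U)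
    (i j : Fin n) : ContDiffOn ℝ k (fun w => formII x ξ w i j) U :=
  hξ.inner ℝ (hx.contDiffOn_pd_pd i j)

theorem contDiffOn_gaussCurvature {k : ℕ} (hx : IsHypersurface (k + 2) U x)
    (hξ : ContDiffOn ℝ k ξ U) : ContDiffOn ℝ k (gaussCurvature x ξ) U := by
  have hx' : IsHypersurface (k + 1) U x := hx.of_le (by gcongr; norm_num)
  exact (contDiffOn_det (contDiffOn_formII hx hξ)).div (contDiffOn_det (contDiffOn_formI hx'))
    fun w hw => det_formI_ne_zero hx hw

theorem inner_pd_normal_pd (hx : IsHypersurface 2 U x) (hξ : IsEuclideanNormalization U x ξ)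
    (hu : u ∈ U) (i j : Fin n) : inner ℝ (pd i ξ u) (pd j x u) = -formII x ξ u i j := by
  have hd : DifferentiableAt ℝ (pd j x) u :=
    differentiableAt_of_contDiffOn (m := ((1 : ℕ) : WithTop ℕ∞)) hx.isOpen hu (by simp)
      (IsHypersurface.contDiffOn_pd (by simpa [one_add_one_eq_two] using hx) j)
  have h1 := pd_inner (differentiableAt_normal hx hξ hu) hd i
  rw [pd_congr hx.isOpen hu (g := fun _ => (0 : ℝ)) (fun w hw => hξ.normal w hw j) i] at h1
  have h2 : pd i (fun _ : E n => (0 : ℝ)) u = 0 := by simp [pd]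
  have h3 : formII x ξ u i j = inner ℝ (ξ u) (pd i (pd j x) u) := formII_comm hx hu i j
  rw [h3]
  linarith

/-- The Weingarten equations. -/
theorem pd_normal_eq (hx : IsHypersurface 2 U x) (hξ : IsEuclideanNormalization U x ξ)
    (hu : u ∈ U) (i : Fin n) :
    pd i ξ u = ∑ k, (-(formII x ξ u * (formI x u)⁻¹) i k) • pd k x u := by
  refine eq_of_mem_tangentSpace_of_inner_eq (pd_normal_mem_tangentSpace hx hξ hu i)
    (Submodule.sum_mem _ fun k _ => Submodule.smul_mem _ _ (pd_mem_tangentSpace x u k))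
    fun l => ?_
  rw [inner_pd_normal_pd hx hξ hu]
  have h1 : ((formII x ξ u * (formI x u)⁻¹) * formI x u) i l = formII x ξ u i l := by
    rw [Matrix.mul_assoc, Matrix.nonsing_inv_mul _ (isUnit_iff_ne_zero.2 (det_formI_ne_zero hx hu)),
      Matrix.mul_one]
  rw [← h1, Matrix.mul_apply, sum_inner]
  simp [real_inner_smul_left, formI]

theorem formIII_eq (hx : IsHypersurface 2 U x) (hξ : IsEuclideanNormalization U x ξ)
    (hu : u ∈ U) : formIII ξ u = formII x ξ u * (formI x u)⁻¹ * formII x ξ u := by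
  ext i j
  rw [formIII, Matrix.of_apply, pd_normal_eq hx hξ hu i, sum_inner, Matrix.mul_apply]
  refine Finset.sum_congr rfl fun k _ => ?_
  rw [real_inner_smul_left, real_inner_comm, inner_pd_normal_pd hx hξ hu, formII_comm hx hu j k]
  ring

/-- `∇^{III}(f, ξ) = -∇^{II}(f, x)`. -/
theorem beltrami_formIII_normal (hx : IsHypersurface 2 U x) (hξ : IsEuclideanNormalization U x ξ)
    (hu : u ∈ U) (hK : gaussCurvature x ξ u ≠ 0) (f : E n → ℝ) :
    beltrami (formIII ξ) f ξ u = -beltrami (formII x ξ) f x u := by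
  have hg := isUnit_iff_ne_zero.2 (det_formI_ne_zero hx hu)
  have hh := isUnit_iff_ne_zero.2 (det_formII_ne_zero hK)
  have h1 : (formIII ξ u)⁻¹ * (formII x ξ u * (formI x u)⁻¹) = (formII x ξ u)⁻¹ := by
    rw [formIII_eq hx hξ hu, Matrix.mul_inv_rev, Matrix.mul_assoc, Matrix.nonsing_inv_mul,
      Matrix.mul_one]
    rw [Matrix.det_mul]
    exact hh.mul (Matrix.isUnit_nonsing_inv_det _ hg)
  simp only [beltrami, pd_normal_eq hx hξ hu]
  rw [← Finset.sum_neg_distrib]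
  refine Finset.sum_congr rfl fun i _ => ?_
  simp only [Finset.smul_sum]
  rw [Finset.sum_comm, ← Finset.sum_neg_distrib]
  refine Finset.sum_congr rfl fun k _ => ?_
  rw [← h1, Matrix.mul_apply, ← neg_smul, Finset.sum_mul, ← Finset.sum_neg_distrib,
    Finset.sum_smul]
  refine Finset.sum_congr rfl fun j _ => ?_
  rw [smul_smul]
  congr 1
  ring

/-- The unit normal field gains regularity: by the Weingarten equations its first derivatives
are as regular as `II`, `I` and the tangent vectors. -/
theorem contDiffOn_normal_succ {k : ℕ} (hx : IsHypersurface (k + 2) U x)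
    (hξ : IsEuclideanNormalization U x ξ) (hk : ContDiffOn ℝ k ξ U) :
    ContDiffOn ℝ (k + 1) ξ U := by
  have hx1 : IsHypersurface (k + 1) U x := hx.of_le (by gcongr; norm_num)
  refine contDiffOn_succ_of_pd hx.isOpen (hξ.contDiffOn.differentiableOn (by simp)) fun i => ?_
  have h1 : ContDiffOn ℝ k
      (fun w => ∑ l, (-(formII x ξ w * (formI x w)⁻¹) i l) • pd l x w) U := by
    refine ContDiffOn.sum fun l _ => ContDiffOn.fun_smul (ContDiffOn.neg ?_) (hx1.contDiffOn_pd l)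
    simp only [Matrix.mul_apply]
    exact ContDiffOn.sum fun j _ => (contDiffOn_formII hx hk i j).mul
      (contDiffOn_inv_apply (contDiffOn_formI hx1) (fun w hw => det_formI_ne_zero hx hw) j l)
  exact h1.congr fun w hw => pd_normal_eq (hx.of_le (by simp)) hξ hw i

end EuclideanFrame

/-! ### Relative normalizations -/

section RelativeNormalization

variable {n : ℕ} {U : Set (E n)} {x ξ y : E n → E (n + 1)} {u : E n}

theorem support_ne_zero (hx : IsHypersurface 3 U x) (hξ : IsEuclideanNormalization U x ξ)
    (hy : IsRelativeNormalization 1 U x y) (hu : u ∈ U) : support ξ y u ≠ 0 := fun h =>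
  hy.transversal u hu (mem_tangentSpace_of_inner_normal_eq_zero hx hξ hu h)

theorem differentiableAt_support (hx : IsHypersurface 3 U x)
    (hξ : IsEuclideanNormalization U x ξ) (hy : IsRelativeNormalization 1 U x y) (hu : u ∈ U) :
    DifferentiableAt ℝ (support ξ y) u :=
  (differentiableAt_normal hx hξ hu).inner ℝ
    (differentiableAt_of_contDiffOn hx.isOpen hu le_rfl hy.contDiffOn)

theorem pd_support (hx : IsHypersurface 3 U x) (hξ : IsEuclideanNormalization U x ξ)
    (hy : IsRelativeNormalization 1 U x y) (hu : u ∈ U) (i : Fin n) :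
    pd i (support ξ y) u = inner ℝ (pd i ξ u) (y u) := by
  have h1 := pd_inner (differentiableAt_normal hx hξ hu)
    (differentiableAt_of_contDiffOn hx.isOpen hu le_rfl hy.contDiffOn) i
  have h2 : (inner ℝ (ξ u) (pd i y u) : ℝ) = 0 :=
    (Submodule.mem_orthogonal' _ _).1 (normal_mem_orthogonal hξ hu) _ (hy.equitangent u hu i)
  rw [h2, zero_add] at h1
  exact h1

theorem covector_eq (hx : IsHypersurface 3 U x) (hξ : IsEuclideanNormalization U x ξ)
    (hy : IsRelativeNormalization 1 U x y) (hu : u ∈ U) :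
    covector x y u = (support ξ y u)⁻¹ • ξ u := by
  refine (covector_unique x y u (hx.immersion u hu) (hy.transversal u hu) _ (fun i => ?_) ?_).symm
  · rw [real_inner_smul_left, hξ.normal u hu, mul_zero]
  · rw [real_inner_smul_left]
    exact inv_mul_cancel₀ (support_ne_zero hx hξ hy hu)

theorem relMetric_eq (hx : IsHypersurface 3 U x) (hξ : IsEuclideanNormalization U x ξ)
    (hy : IsRelativeNormalization 1 U x y) (hu : u ∈ U) :
    relMetric x y u = (support ξ y u)⁻¹ • formII x ξ u := by
  ext i j
  simp [relMetric, formII, covector_eq hx hξ hy hu, real_inner_smul_left]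

theorem relMetric_comm (hx : IsHypersurface 3 U x) (hu : u ∈ U) (i j : Fin n) :
    relMetric x y u i j = relMetric x y u j i := by
  simp only [relMetric, Matrix.of_apply,
    pd_comm hx.isOpen hu (hx.contDiffOn.of_le (by norm_num)) i j]

theorem inv_relMetric_eq (hx : IsHypersurface 3 U x) (hξ : IsEuclideanNormalization U x ξ)
    (hK : gaussCurvature x ξ u ≠ 0) (hy : IsRelativeNormalization 1 U x y) (hu : u ∈ U) :
    (relMetric x y u)⁻¹ = support ξ y u • (formII x ξ u)⁻¹ := by
  have hq := support_ne_zero hx hξ hy hu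
  refine Matrix.inv_eq_left_inv ?_
  rw [relMetric_eq hx hξ hy hu, Matrix.smul_mul, Matrix.mul_smul, smul_smul, mul_inv_cancel₀ hq,
    one_smul, Matrix.nonsing_inv_mul _ (isUnit_iff_ne_zero.2 (det_formII_ne_zero hK))]

theorem det_relMetric_ne_zero (hx : IsHypersurface 3 U x) (hξ : IsEuclideanNormalization U x ξ)
    (hK : gaussCurvature x ξ u ≠ 0) (hy : IsRelativeNormalization 1 U x y) (hu : u ∈ U) :
    (relMetric x y u).det ≠ 0 := by
  rw [relMetric_eq hx hξ hy hu, Matrix.det_smul]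
  exact mul_ne_zero (pow_ne_zero _ (inv_ne_zero (support_ne_zero hx hξ hy hu)))
    (det_formII_ne_zero hK)

theorem beltrami_relMetric (hx : IsHypersurface 3 U x) (hξ : IsEuclideanNormalization U x ξ)
    (hK : gaussCurvature x ξ u ≠ 0) (hy : IsRelativeNormalization 1 U x y) (hu : u ∈ U)
    (f : E n → ℝ) :
    beltrami (relMetric x y) f x u = support ξ y u • beltrami (formII x ξ) f x u := by
  simp only [beltrami, inv_relMetric_eq hx hξ hK hy hu, Finset.smul_sum, smul_smul,
    Matrix.smul_apply, smul_eq_mul, mul_assoc]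

theorem differentiableAt_formII (hx : IsHypersurface 3 U x)
    (hξ : IsEuclideanNormalization U x ξ) (hu : u ∈ U) (i j : Fin n) :
    DifferentiableAt ℝ (fun w => formII x ξ w i j) u :=
  differentiableAt_of_contDiffOn (m := ((1 : ℕ) : WithTop ℕ∞)) hx.isOpen hu (by simp)
    (contDiffOn_formII (hx.of_le (by norm_num)) (by simpa using hξ.contDiffOn) i j)

theorem differentiableAt_formI (hx : IsHypersurface 3 U x) (hu : u ∈ U) (i j : Fin n) :
    DifferentiableAt ℝ (fun w => formI x w i j) u :=
  differentiableAt_of_contDiffOn (m := ((2 : ℕ) : WithTop ℕ∞)) hx.isOpen hu (by norm_num)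
    (contDiffOn_formI (hx.of_le (by norm_num)) i j)

theorem pd_formII (hx : IsHypersurface 3 U x) (hξ : IsEuclideanNormalization U x ξ) (hu : u ∈ U)
    (i j k : Fin n) :
    pd k (fun w => formII x ξ w i j) u
      = inner ℝ (ξ u) (pd k (pd j (pd i x)) u) + inner ℝ (pd k ξ u) (pd j (pd i x) u) :=
  pd_inner (differentiableAt_normal hx hξ hu)
    (differentiableAt_of_contDiffOn (m := ((1 : ℕ) : WithTop ℕ∞)) hx.isOpen hu (by simp)
      (IsHypersurface.contDiffOn_pd_pd (hx.of_le (by norm_num)) i j)) k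

/-- The Darboux tensor in terms of the relative metric: all Christoffel symbols pair up to
partial derivatives of `G`. -/
theorem darboux_eq_sub (hx : IsHypersurface 3 U x) (hξ : IsEuclideanNormalization U x ξ)
    (hK : gaussCurvature x ξ u ≠ 0) (hy : IsRelativeNormalization 1 U x y) (hu : u ∈ U)
    (i j k : Fin n) :
    darboux x y i j k u = inner ℝ (covector x y u) (pd k (pd j (pd i x)) u)
      - 1 / 2 * (pd i (fun w => relMetric x y w j k) u + pd j (fun w => relMetric x y w i k) u
          + pd k (fun w => relMetric x y w i j) u) := by
  have hdet := det_relMetric_ne_zero hx hξ hK hy hu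
  have h2 : ∀ i j, (inner ℝ (covector x y u) (covDeriv₂ (relMetric x y) x i j u) : ℝ)
      = relMetric x y u i j := fun i j => by
    simp [covDeriv₂, inner_sub_right, inner_sum, inner_smul_right, covector_normal, relMetric]
  have h1 : ∀ i j, (inner ℝ (covector x y u) (pd j (pd i x) u) : ℝ) = relMetric x y u i j :=
    fun i j => rfl
  have hsymm : ∀ l i j, pd l (fun w => relMetric x y w i j) u
      = pd l (fun w => relMetric x y w j i) u :=
    fun l i j => pd_congr hx.isOpen hu (fun w hw => relMetric_comm hx hw i j) l
  have hs : ∀ i j l, ∑ m, christoffel (relMetric x y) m i j u * relMetric x y u m l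
      = 1 / 2 * (pd i (fun w => relMetric x y w j l) u + pd j (fun w => relMetric x y w i l) u
          - pd l (fun w => relMetric x y w i j) u) := fun i j l => by
    rw [← sum_mul_christoffel hdet]
    exact Finset.sum_congr rfl fun m _ => by rw [relMetric_comm hx hu m l, mul_comm]
  have hs' : ∀ i j l, ∑ m, christoffel (relMetric x y) m i j u * relMetric x y u l m
      = 1 / 2 * (pd i (fun w => relMetric x y w j l) u + pd j (fun w => relMetric x y w i l) u
          - pd l (fun w => relMetric x y w i j) u) := fun i j l => by
    rw [← sum_mul_christoffel hdet]
    exact Finset.sum_congr rfl fun m _ => mul_comm _ _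
  simp only [darboux, covDeriv₃, inner_sub_right, inner_sum, inner_add_right, inner_smul_right,
    covector_normal, mul_zero, zero_add, h1, h2, hs, hs']
  rw [hsymm i k j, hsymm j k i, hsymm k j i]
  ring

/-- The Darboux tensor in terms of the Euclidean invariants and the support function. -/
theorem darboux_eq (hx : IsHypersurface 3 U x) (hξ : IsEuclideanNormalization U x ξ)
    (hK : gaussCurvature x ξ u ≠ 0) (hy : IsRelativeNormalization 1 U x y) (hu : u ∈ U)
    (i j k : Fin n) :
    darboux x y i j k u = 1 / 2 * ((support ξ y u ^ 2)⁻¹ *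
        (pd i (support ξ y) u * formII x ξ u j k + pd j (support ξ y) u * formII x ξ u i k
          + pd k (support ξ y) u * formII x ξ u i j)
      - (support ξ y u)⁻¹ * (pd i (fun w => formII x ξ w j k) u
          + inner ℝ (pd j ξ u) (pd i (pd k x) u) + inner ℝ (pd k ξ u) (pd i (pd j x) u))) := by
  have hq := support_ne_zero hx hξ hy hu
  have hG : ∀ l i j, pd l (fun w => relMetric x y w i j) u
      = (support ξ y u)⁻¹ * pd l (fun w => formII x ξ w i j) u
        - (support ξ y u ^ 2)⁻¹ * pd l (support ξ y) u * formII x ξ u i j := fun l i j => by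
    rw [← pd_inv_mul (differentiableAt_support hx hξ hy hu)
      (differentiableAt_formII hx hξ hu i j) hq]
    refine pd_congr hx.isOpen hu (fun w hw => ?_) l
    rw [relMetric_eq hx hξ hy hw]
    rfl
  have hx2 := hx.contDiffOn.of_le (show (2 : WithTop ℕ∞) ≤ 3 by norm_num)
  have hpx : ContDiffOn ℝ 2 (pd i x) U :=
    contDiffOn_pd hx.isOpen (hx.contDiffOn.of_le (by norm_num)) i
  have hD : pd j (pd k (pd i x)) u = pd k (pd j (pd i x)) u := pd_comm hx.isOpen hu hpx k j
  rw [darboux_eq_sub hx hξ hK hy hu, covector_eq hx hξ hy hu, real_inner_smul_left, hG, hG, hG,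
    pd_formII hx hξ hu i k j, pd_formII hx hξ hu i j k, hD, pd_comm hx.isOpen hu hx2 i k,
    pd_comm hx.isOpen hu hx2 i j]
  ring

/-- `h^{jk} ⟨ξ_{/j}, x_{/ki}⟩ = -½ ∂_i ln det g`, by the Weingarten equations. -/
theorem sum_inv_formII_mul_inner (hx : IsHypersurface 3 U x)
    (hξ : IsEuclideanNormalization U x ξ) (hK : gaussCurvature x ξ u ≠ 0) (hu : u ∈ U)
    (i : Fin n) :
    ∑ j, ∑ k, (formII x ξ u)⁻¹ j k * inner ℝ (pd j ξ u) (pd i (pd k x) u)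
      = -(1 / 2 * ((formI x u).det⁻¹ * pd i (fun w => (formI x w).det) u)) := by
  have hx2 : IsHypersurface 2 U x := hx.of_le (by norm_num)
  have hd : ∀ k, DifferentiableAt ℝ (pd k x) u := fun k =>
    differentiableAt_of_contDiffOn (m := ((2 : ℕ) : WithTop ℕ∞)) hx.isOpen hu (by norm_num)
      (IsHypersurface.contDiffOn_pd (hx.of_le (by norm_num)) k)
  have hB : ∀ k m, (formI x u)⁻¹ k m
      = ∑ j, (formII x ξ u)⁻¹ k j * (formII x ξ u * (formI x u)⁻¹) j m := fun k m => by
    rw [← Matrix.mul_apply, ← Matrix.mul_assoc, Matrix.nonsing_inv_mul _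
      (isUnit_iff_ne_zero.2 (det_formII_ne_zero hK)), Matrix.one_mul]
  -- both sides reduce to `-g^{km} ⟨x_{/m}, x_{/ki}⟩`
  have h1 : ∑ j, ∑ k, (formII x ξ u)⁻¹ j k * (inner ℝ (pd j ξ u) (pd i (pd k x) u) : ℝ)
      = -∑ k, ∑ m, (formI x u)⁻¹ k m * (inner ℝ (pd m x u) (pd i (pd k x) u) : ℝ) := by
    rw [Finset.sum_comm, ← Finset.sum_neg_distrib]
    refine Finset.sum_congr rfl fun k _ => ?_
    simp only [pd_normal_eq hx2 hξ hu, sum_inner, real_inner_smul_left, Finset.mul_sum]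
    rw [Finset.sum_comm, ← Finset.sum_neg_distrib]
    refine Finset.sum_congr rfl fun m _ => ?_
    rw [hB, Finset.sum_mul, ← Finset.sum_neg_distrib]
    refine Finset.sum_congr rfl fun j _ => ?_
    rw [inv_formII_comm hx2 hu j k]
    ring
  have h2 : ∑ k, ∑ m, (formI x u)⁻¹ k m * pd i (fun w => formI x w m k) u
      = 2 * ∑ k, ∑ m, (formI x u)⁻¹ k m * (inner ℝ (pd m x u) (pd i (pd k x) u) : ℝ) := by
    have h3 : ∀ k m, pd i (fun w => formI x w m k) u
        = inner ℝ (pd m x u) (pd i (pd k x) u) + inner ℝ (pd i (pd m x) u) (pd k x u) :=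
      fun k m => pd_inner (hd m) (hd k) i
    simp only [h3, mul_add, Finset.sum_add_distrib]
    rw [two_mul]
    congr 1
    rw [Finset.sum_comm]
    refine Finset.sum_congr rfl fun k _ => Finset.sum_congr rfl fun m _ => ?_
    rw [inv_formI_comm, real_inner_comm]
  rw [inv_det_mul_pd_det (differentiableAt_formI hx hu), h1, h2]
  ring

theorem inv_gaussCurvature_mul_pd (hx : IsHypersurface 3 U x)
    (hξ : IsEuclideanNormalization U x ξ) (hK : gaussCurvature x ξ u ≠ 0) (hu : u ∈ U)
    (i : Fin n) :
    (gaussCurvature x ξ u)⁻¹ * pd i (gaussCurvature x ξ) u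
      = (formII x ξ u).det⁻¹ * pd i (fun w => (formII x ξ w).det) u
        - (formI x u).det⁻¹ * pd i (fun w => (formI x w).det) u := by
  have hg := det_formI_ne_zero hx hu
  have hh := det_formII_ne_zero hK
  have hgd : DifferentiableAt ℝ (fun w => (formI x w).det) u :=
    differentiableAt_of_contDiffOn (m := ((2 : ℕ) : WithTop ℕ∞)) hx.isOpen hu (by norm_num)
      (contDiffOn_det (contDiffOn_formI (hx.of_le (by norm_num))))
  have hhd : DifferentiableAt ℝ (fun w => (formII x ξ w).det) u :=
    differentiableAt_of_contDiffOn (m := ((1 : ℕ) : WithTop ℕ∞)) hx.isOpen hu (by norm_num)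
      (contDiffOn_det (contDiffOn_formII (hx.of_le (by norm_num)) (by simpa using hξ.contDiffOn)))
  have h1 : pd i (gaussCurvature x ξ) u
      = pd i (fun w => ((formI x w).det)⁻¹ * (formII x ξ w).det) u :=
    pd_congr hx.isOpen hu (fun w _ => div_eq_inv_mul _ _) i
  rw [h1, pd_inv_mul hgd hhd hg, gaussCurvature]
  field_simp

/-- The trace `A_{ijk} G^{jk} = -½ ∂_i ln |K| + ½ (n + 2) ∂_i ln |q|` of the Darboux tensor. -/
theorem sum_darboux_mul_inv (hx : IsHypersurface 3 U x) (hξ : IsEuclideanNormalization U x ξ)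
    (hK : gaussCurvature x ξ u ≠ 0) (hy : IsRelativeNormalization 1 U x y) (hu : u ∈ U)
    (i : Fin n) :
    ∑ j, ∑ k, darboux x y i j k u * (relMetric x y u)⁻¹ j k
      = -(1 / 2) * ((gaussCurvature x ξ u)⁻¹ * pd i (gaussCurvature x ξ) u)
        + ((n : ℝ) + 2) / 2 * ((support ξ y u)⁻¹ * pd i (support ξ y) u) := by
  have hx2 : IsHypersurface 2 U x := hx.of_le (by norm_num)
  have hq := support_ne_zero hx hξ hy hu
  have hh := det_formII_ne_zero hK
  have hinv : ∀ i k, ∑ j, (formII x ξ u)⁻¹ i j * formII x ξ u j k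
      = (1 : Matrix (Fin n) (Fin n) ℝ) i k := sum_inv_mul_eq hh
  -- the contractions of `h^{jk}` with the six terms of the Darboux tensor
  have c1 : ∑ j, ∑ k, (formII x ξ u)⁻¹ j k * formII x ξ u j k = n := by
    have : ∀ j, ∑ k, (formII x ξ u)⁻¹ j k * formII x ξ u j k = 1 := fun j => by
      simp only [formII_comm (ξ := ξ) hx2 hu j]
      rw [hinv, Matrix.one_apply_eq]
    simp [this]
  have c2 : ∑ j, ∑ k, (formII x ξ u)⁻¹ j k * (pd j (support ξ y) u * formII x ξ u i k)
      = pd i (support ξ y) u := by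
    have : ∀ j, ∑ k, (formII x ξ u)⁻¹ j k * (pd j (support ξ y) u * formII x ξ u i k)
        = pd j (support ξ y) u * (1 : Matrix (Fin n) (Fin n) ℝ) j i := fun j => by
      rw [← hinv, Finset.mul_sum]
      exact Finset.sum_congr rfl fun k _ => by rw [formII_comm hx2 hu i k]; ring
    simp [this, Matrix.one_apply]
  have c3 : ∑ j, ∑ k, (formII x ξ u)⁻¹ j k * (pd k (support ξ y) u * formII x ξ u i j)
      = pd i (support ξ y) u := by
    rw [Finset.sum_comm, ← c2]
    exact Finset.sum_congr rfl fun j _ => Finset.sum_congr rfl fun k _ => by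
      rw [inv_formII_comm hx2 hu k j]
  have c4 : ∑ j, ∑ k, (formII x ξ u)⁻¹ j k * pd i (fun w => formII x ξ w j k) u
      = (formII x ξ u).det⁻¹ * pd i (fun w => (formII x ξ w).det) u := by
    rw [inv_det_mul_pd_det (differentiableAt_formII hx hξ hu)]
    exact Finset.sum_congr rfl fun j _ => Finset.sum_congr rfl fun k _ => by
      rw [pd_congr hx.isOpen hu (fun w hw => formII_comm (ξ := ξ) hx2 hw j k) i]
  have c5 := sum_inv_formII_mul_inner hx hξ hK hu i
  have c6 : ∑ j, ∑ k, (formII x ξ u)⁻¹ j k * (inner ℝ (pd k ξ u) (pd i (pd j x) u) : ℝ)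
      = ∑ j, ∑ k, (formII x ξ u)⁻¹ j k * inner ℝ (pd j ξ u) (pd i (pd k x) u) := by
    rw [Finset.sum_comm]
    exact Finset.sum_congr rfl fun j _ => Finset.sum_congr rfl fun k _ => by
      rw [inv_formII_comm hx2 hu k j]
  have key : ∀ j k, darboux x y i j k u * (relMetric x y u)⁻¹ j k
      = 1 / 2 * ((support ξ y u)⁻¹ * (pd i (support ξ y) u
            * ((formII x ξ u)⁻¹ j k * formII x ξ u j k)
          + (formII x ξ u)⁻¹ j k * (pd j (support ξ y) u * formII x ξ u i k)
          + (formII x ξ u)⁻¹ j k * (pd k (support ξ y) u * formII x ξ u i j))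
        - ((formII x ξ u)⁻¹ j k * pd i (fun w => formII x ξ w j k) u
          + (formII x ξ u)⁻¹ j k * inner ℝ (pd j ξ u) (pd i (pd k x) u)
          + (formII x ξ u)⁻¹ j k * inner ℝ (pd k ξ u) (pd i (pd j x) u))) := fun j k => by
    rw [darboux_eq hx hξ hK hy hu, inv_relMetric_eq hx hξ hK hy hu, Matrix.smul_apply,
      smul_eq_mul]
    field_simp
  simp only [key, ← Finset.mul_sum, Finset.sum_sub_distrib, Finset.sum_add_distrib]
  rw [c1, c2, c3, c4, c6, c5, inv_gaussCurvature_mul_pd hx hξ hK hu]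
  ring

end RelativeNormalization

/-! ### The Tchebychev vector field as a gradient -/

section Tchebychev

variable {n : ℕ} {U : Set (E n)} {x ξ y : E n → E (n + 1)} {u : E n}

/-- No absolute values are needed on the right, as `Real.log t = ln |t|`. -/
theorem log_phi (hK : gaussCurvature x ξ u ≠ 0) (hq : support ξ y u ≠ 0) :
    Real.log (phi x ξ y u) = -1 / (2 * (n : ℝ)) * Real.log (gaussCurvature x ξ u)
      + ((n : ℝ) + 2) / (2 * (n : ℝ)) * Real.log (support ξ y u) := by
  have hK' := abs_pos.2 hK
  have hq' := abs_pos.2 hq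
  rw [phi, Real.log_mul (Real.rpow_pos_of_pos hK' _).ne' (Real.rpow_pos_of_pos hq' _).ne',
    Real.log_rpow hK', Real.log_rpow hq', Real.log_abs, Real.log_abs]

theorem differentiableAt_gaussCurvature (hx : IsHypersurface 3 U x)
    (hξ : IsEuclideanNormalization U x ξ) (hu : u ∈ U) :
    DifferentiableAt ℝ (gaussCurvature x ξ) u :=
  differentiableAt_of_contDiffOn (m := ((1 : ℕ) : WithTop ℕ∞)) hx.isOpen hu (by simp)
    (contDiffOn_gaussCurvature (hx.of_le (by norm_num)) (by simpa using hξ.contDiffOn))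

theorem pd_log_phi (hx : IsHypersurface 3 U x) (hξ : IsEuclideanNormalization U x ξ)
    (hK : ∀ u ∈ U, gaussCurvature x ξ u ≠ 0) (hy : IsRelativeNormalization 1 U x y) (hu : u ∈ U)
    (i : Fin n) :
    pd i (fun w => Real.log (phi x ξ y w)) u
      = -1 / (2 * (n : ℝ)) * (gaussCurvature x ξ u)⁻¹ * pd i (gaussCurvature x ξ) u
        + ((n : ℝ) + 2) / (2 * (n : ℝ)) * (support ξ y u)⁻¹ * pd i (support ξ y) u := by
  rw [pd_congr hx.isOpen hu
    (fun w hw => log_phi (hK w hw) (support_ne_zero hx hξ hy hw)) i]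
  exact pd_const_mul_log_add (differentiableAt_gaussCurvature hx hξ hu)
    (differentiableAt_support hx hξ hy hu) (hK u hu) (support_ne_zero hx hξ hy hu) _ _ i

theorem tchebychevComp_eq (hn : 1 ≤ n) (hx : IsHypersurface 3 U x)
    (hξ : IsEuclideanNormalization U x ξ) (hK : ∀ u ∈ U, gaussCurvature x ξ u ≠ 0)
    (hy : IsRelativeNormalization 1 U x y) (hu : u ∈ U) (m : Fin n) :
    tchebychevComp x y m u
      = ∑ i, (relMetric x y u)⁻¹ i m * pd i (fun w => Real.log (phi x ξ y w)) u := by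
  have hn0 : (n : ℝ) ≠ 0 := by positivity
  rw [tchebychevComp, Finset.mul_sum]
  refine Finset.sum_congr rfl fun i _ => ?_
  simp only [← Finset.sum_mul]
  rw [sum_darboux_mul_inv hx hξ (hK u hu) hy hu, pd_log_phi hx hξ hK hy hu]
  field_simp

/-- `T` is the gradient of `ln φ` with respect to the relative metric. -/
theorem tchebychev_eq_beltrami (hn : 1 ≤ n) (hx : IsHypersurface 3 U x)
    (hξ : IsEuclideanNormalization U x ξ) (hK : ∀ u ∈ U, gaussCurvature x ξ u ≠ 0)
    (hy : IsRelativeNormalization 1 U x y) (hu : u ∈ U) :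
    tchebychev x y u
      = beltrami (relMetric x y) (fun w => Real.log (phi x ξ y w)) x u := by
  simp only [tchebychev, tchebychevComp_eq hn hx hξ hK hy hu, beltrami, Finset.sum_smul]
  exact Finset.sum_comm

/-- `T` as a combination of the gradients of `K` and `q` with respect to `II`. -/
theorem tchebychev_eq (hn : 1 ≤ n) (hx : IsHypersurface 3 U x)
    (hξ : IsEuclideanNormalization U x ξ) (hK : ∀ u ∈ U, gaussCurvature x ξ u ≠ 0)
    (hy : IsRelativeNormalization 1 U x y) (hu : u ∈ U) :
    tchebychev x y u = support ξ y u •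
      ((-1 / (2 * (n : ℝ)) * (gaussCurvature x ξ u)⁻¹)
          • beltrami (formII x ξ) (gaussCurvature x ξ) x u
        + (((n : ℝ) + 2) / (2 * (n : ℝ)) * (support ξ y u)⁻¹)
          • beltrami (formII x ξ) (support ξ y) x u) := by
  rw [tchebychev_eq_beltrami hn hx hξ hK hy hu, beltrami_relMetric hx hξ (hK u hu) hy hu,
    beltrami_of_pd_eq _ (fun i => pd_log_phi hx hξ hK hy hu i)]

/-- The normalization `ξ` has support function `1`, so only the curvature term remains. -/
theorem tchebychev_normal (hn : 1 ≤ n) (hx : IsHypersurface 3 U x)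
    (hξ : IsEuclideanNormalization U x ξ) (hK : ∀ u ∈ U, gaussCurvature x ξ u ≠ 0) (hu : u ∈ U) :
    tchebychev x ξ u = (-1 / (2 * (n : ℝ)) * (gaussCurvature x ξ u)⁻¹)
      • beltrami (formII x ξ) (gaussCurvature x ξ) x u := by
  have h1 : ∀ w ∈ U, support ξ ξ w = 1 := fun w hw => inner_normal_self hξ hw
  have h2 : beltrami (formII x ξ) (support ξ ξ) x u = 0 := by
    have : ∀ i, pd i (support ξ ξ) u = 0 := fun i => by
      rw [pd_congr hx.isOpen hu h1 i]
      simp [pd]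
    simp [beltrami, this]
  rw [tchebychev_eq hn hx hξ hK (hξ.isRelativeNormalization hx) hu, h2, h1 u hu, one_smul,
    smul_zero, add_zero]

theorem vectorQ_eq (hx : IsHypersurface 3 U x) (hξ : IsEuclideanNormalization U x ξ)
    (hK : gaussCurvature x ξ u ≠ 0) (hu : u ∈ U) :
    vectorQ ξ y u = -((1 / (2 * (n : ℝ) * support ξ y u))
      • beltrami (formII x ξ) (support ξ y) x u) := by
  rw [vectorQ, beltrami_formIII_normal (hx.of_le (by norm_num)) hξ hu hK, smul_neg]

theorem tchebychev_eq_sub (hn : 1 ≤ n) (hx : IsHypersurface 3 U x)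
    (hξ : IsEuclideanNormalization U x ξ) (hK : ∀ u ∈ U, gaussCurvature x ξ u ≠ 0)
    (hy : IsRelativeNormalization 1 U x y) (hu : u ∈ U) :
    tchebychev x y u = support ξ y u • tchebychev x ξ u
      - (support ξ y u * ((n : ℝ) + 2)) • vectorQ ξ y u := by
  have hq := support_ne_zero hx hξ hy hu
  have hn0 : (n : ℝ) ≠ 0 := by positivity
  rw [tchebychev_eq hn hx hξ hK hy hu, tchebychev_normal hn hx hξ hK hu,
    vectorQ_eq hx hξ (hK u hu) hu, smul_add, smul_neg, sub_neg_eq_add, smul_smul _ _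
      (beltrami (formII x ξ) (support ξ y) x u), smul_smul _ _
      (beltrami (formII x ξ) (support ξ y) x u)]
  congr 2
  field_simp

/-- The tangential component of `y` is `∇^{III}(q, ξ) = -∇^{II}(q, x)`, because
`q_{/i} = ⟨ξ_{/i}, y⟩` determines the components of `y`. -/
theorem sub_support_smul_eq (hx : IsHypersurface 3 U x) (hξ : IsEuclideanNormalization U x ξ)
    (hK : gaussCurvature x ξ u ≠ 0) (hy : IsRelativeNormalization 1 U x y) (hu : u ∈ U) :
    y u - support ξ y u • ξ u = -beltrami (formII x ξ) (support ξ y) x u := by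
  have hx2 : IsHypersurface 2 U x := hx.of_le (by norm_num)
  have h0 : (inner ℝ (ξ u) (y u - support ξ y u • ξ u) : ℝ) = 0 := by
    rw [inner_sub_right, inner_smul_right, inner_normal_self hξ hu, mul_one, support, sub_self]
  obtain ⟨a, ha⟩ := exists_eq_sum_of_mem_tangentSpace
    (mem_tangentSpace_of_inner_normal_eq_zero hx hξ hu h0)
  have hpd : ∀ i, pd i (support ξ y) u = -∑ m, formII x ξ u i m * a m := fun i => by
    have h1 : (inner ℝ (pd i ξ u) (ξ u) : ℝ) = 0 :=
      (Submodule.mem_orthogonal _ _).1 (normal_mem_orthogonal hξ hu) _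
        (pd_normal_mem_tangentSpace hx hξ hu i)
    have h2 : y u = ∑ m, a m • pd m x u + support ξ y u • ξ u := by rw [← ha, sub_add_cancel]
    rw [pd_support hx hξ hy hu, h2, inner_add_right, inner_smul_right, h1, mul_zero, add_zero,
      inner_sum, ← Finset.sum_neg_distrib]
    refine Finset.sum_congr rfl fun m _ => ?_
    rw [inner_smul_right, inner_pd_normal_pd hx2 hξ hu]
    ring
  have hc : ∀ j, ∑ i, (formII x ξ u)⁻¹ i j * pd i (support ξ y) u = -a j := fun j => by
    simp only [hpd, inv_formII_comm hx2 hu _ j, mul_neg, Finset.sum_neg_distrib, Finset.mul_sum]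
    rw [Finset.sum_comm]
    simp only [← mul_assoc, ← Finset.sum_mul, sum_inv_mul_eq (det_formII_ne_zero hK)]
    simp [Matrix.one_apply]
  rw [ha, beltrami, Finset.sum_comm]
  simp only [← Finset.sum_smul, hc, neg_smul, Finset.sum_neg_distrib, neg_neg]

theorem two_mul_support_smul_vectorQ (hn : 1 ≤ n) (hx : IsHypersurface 3 U x)
    (hξ : IsEuclideanNormalization U x ξ) (hK : gaussCurvature x ξ u ≠ 0)
    (hy : IsRelativeNormalization 1 U x y) (hu : u ∈ U) :
    (2 * (n : ℝ) * support ξ y u) • vectorQ ξ y u = y u - support ξ y u • ξ u := by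
  have hq := support_ne_zero hx hξ hy hu
  have hn0 : (n : ℝ) ≠ 0 := by positivity
  rw [sub_support_smul_eq hx hξ hK hy hu, vectorQ_eq hx hξ hK hu, smul_neg, smul_smul,
    mul_one_div_cancel (by positivity), one_smul]

theorem normalization_eq (hn : 1 ≤ n) (hx : IsHypersurface 3 U x)
    (hξ : IsEuclideanNormalization U x ξ) (hK : gaussCurvature x ξ u ≠ 0)
    (hy : IsRelativeNormalization 1 U x y) (hu : u ∈ U) :
    y u = support ξ y u • ((2 * (n : ℝ)) • vectorQ ξ y u + ξ u) := by
  rw [smul_add, smul_smul, mul_comm (support ξ y u),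
    two_mul_support_smul_vectorQ hn hx hξ hK hy hu, sub_add_cancel]

theorem starProjection_normalization (hn : 1 ≤ n) (hx : IsHypersurface 3 U x)
    (hξ : IsEuclideanNormalization U x ξ) (hK : gaussCurvature x ξ u ≠ 0)
    (hy : IsRelativeNormalization 1 U x y) (hu : u ∈ U) :
    (tangentSpace x u).starProjection (y u)
      = (2 * (n : ℝ) * support ξ y u) • vectorQ ξ y u := by
  rw [two_mul_support_smul_vectorQ hn hx hξ hK hy hu]
  refine Submodule.eq_starProjection_of_mem_orthogonal ?_ ?_
  · refine mem_tangentSpace_of_inner_normal_eq_zero hx hξ hu ?_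
    rw [inner_sub_right, inner_smul_right, inner_normal_self hξ hu, mul_one, support, sub_self]
  · rw [sub_sub_cancel]
    exact Submodule.smul_mem _ _ (normal_mem_orthogonal hξ hu)

theorem inv_support_smul_eq (hn : 1 ≤ n) (hx : IsHypersurface 3 U x)
    (hξ : IsEuclideanNormalization U x ξ) (hK : ∀ u ∈ U, gaussCurvature x ξ u ≠ 0)
    (hy : IsRelativeNormalization 1 U x y) (hu : u ∈ U) :
    (1 / support ξ y u) • ((2 * (n : ℝ)) • tchebychev x y u + ((n : ℝ) + 2) • y u)
      = (2 * (n : ℝ)) • tchebychev x ξ u + ((n : ℝ) + 2) • ξ u := by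
  have hq := support_ne_zero hx hξ hy hu
  have h1 : (2 * (n : ℝ)) • tchebychev x y u + ((n : ℝ) + 2) • y u
      = support ξ y u • ((2 * (n : ℝ)) • tchebychev x ξ u + ((n : ℝ) + 2) • ξ u) := by
    have h2 : y u = (2 * (n : ℝ) * support ξ y u) • vectorQ ξ y u + support ξ y u • ξ u := by
      rw [two_mul_support_smul_vectorQ hn hx hξ (hK u hu) hy hu, sub_add_cancel]
    rw [tchebychev_eq_sub hn hx hξ hK hy hu]
    -- only the summand `y u` is to be rewritten, since `y` also occurs in `q` and in `Q`
    generalize tchebychev x ξ u = T at *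
    generalize vectorQ ξ y u = Q at *
    generalize support ξ y u = q at *
    rw [h2]
    module
  rw [h1, smul_smul, one_div_mul_cancel hq, one_smul]

/-- The support function is one degree smoother than `y`, because
`q_{/i} = ⟨ξ_{/i}, y⟩`. -/
theorem contDiffOn_support (hx : IsHypersurface 3 U x) (hξ : IsEuclideanNormalization U x ξ)
    (hξ2 : ContDiffOn ℝ 2 ξ U) (hy : IsRelativeNormalization 1 U x y) :
    ContDiffOn ℝ 2 (support ξ y) U := by
  have h := contDiffOn_succ_of_pd (k := 1) (f := support ξ y) hx.isOpen
    (fun u hu => (differentiableAt_support hx hξ hy hu).differentiableWithinAt) fun i => by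
      have h1 : ContDiffOn ℝ 1 (pd i ξ) U := contDiffOn_pd hx.isOpen (by norm_num; exact hξ2) i
      exact ((h1.inner ℝ hy.contDiffOn).congr fun w hw => pd_support hx hξ hy hw i)
  norm_num at h
  exact h

theorem contDiffOn_log_phi (hx : IsHypersurface 4 U x) (hξ : IsEuclideanNormalization U x ξ)
    (hK : ∀ u ∈ U, gaussCurvature x ξ u ≠ 0) (hy : IsRelativeNormalization 1 U x y) :
    ContDiffOn ℝ 2 (fun w => Real.log (phi x ξ y w)) U := by
  have hx3 : IsHypersurface 3 U x := hx.of_le (by norm_num)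
  have hξ2 : ContDiffOn ℝ 2 ξ U := by
    have h := contDiffOn_normal_succ (k := 1) (hx.of_le (by norm_num)) hξ
      (by simpa using hξ.contDiffOn)
    norm_num at h
    exact h
  have hKd : ContDiffOn ℝ 2 (gaussCurvature x ξ) U :=
    contDiffOn_gaussCurvature (k := 2) (hx.of_le (by norm_num)) hξ2
  have hq := contDiffOn_support hx3 hξ hξ2 hy
  exact ((contDiffOn_const.mul (hKd.log hK)).add (contDiffOn_const.mul
    (hq.log fun w hw => support_ne_zero hx3 hξ hy hw))).congr
    fun w hw => log_phi (hK w hw) (support_ne_zero hx3 hξ hy hw)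

theorem lower_tchebychevComp (hn : 1 ≤ n) (hx : IsHypersurface 3 U x)
    (hξ : IsEuclideanNormalization U x ξ) (hK : ∀ u ∈ U, gaussCurvature x ξ u ≠ 0)
    (hy : IsRelativeNormalization 1 U x y) (hu : u ∈ U) (i : Fin n) :
    lower (relMetric x y) (tchebychevComp x y) i u
      = pd i (fun w => Real.log (phi x ξ y w)) u := by
  have hG := det_relMetric_ne_zero hx hξ (hK u hu) hy hu
  simp only [lower, tchebychevComp_eq hn hx hξ hK hy hu, Finset.mul_sum]
  rw [Finset.sum_comm]
  have : ∀ j, ∑ m, relMetric x y u i m * (relMetric x y u)⁻¹ j m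
      = (1 : Matrix (Fin n) (Fin n) ℝ) j i := fun j => by
    rw [← sum_inv_mul_eq hG]
    exact Finset.sum_congr rfl fun m _ => by rw [relMetric_comm hx hu i m, mul_comm]
  simp only [← mul_assoc, ← Finset.sum_mul, this]
  simp [Matrix.one_apply]

/-- Covariant components that form a gradient are irrotational. -/
theorem isIrrotational_tchebychevComp (hn : 1 ≤ n) (hx : IsHypersurface 4 U x)
    (hξ : IsEuclideanNormalization U x ξ) (hK : ∀ u ∈ U, gaussCurvature x ξ u ≠ 0)
    (hy : IsRelativeNormalization 1 U x y) :
    IsIrrotational (relMetric x y) U (tchebychevComp x y) := by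
  have hx3 : IsHypersurface 3 U x := hx.of_le (by norm_num)
  have hφ := contDiffOn_log_phi hx hξ hK hy
  have hlow := fun i w (hw : w ∈ U) => lower_tchebychevComp hn hx3 hξ hK hy hw i
  refine ⟨fun i => ?_, fun u hu i j => ?_⟩
  · have h1 : ContDiffOn ℝ 1 (pd i fun w => Real.log (phi x ξ y w)) U :=
      contDiffOn_pd hx.isOpen (by norm_num; exact hφ) i
    exact (h1.congr (hlow i)).differentiableOn (by simp)
  · rw [pd_congr hx.isOpen hu (hlow i) j, pd_congr hx.isOpen hu (hlow j) i,
      pd_comm hx.isOpen hu hφ i j]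
    congr 1
    exact Finset.sum_congr rfl fun k _ => by
      rw [christoffel_comm hx.isOpen hu (fun w hw => relMetric_comm hx3 hw) k i j]

end Tchebychev

end RelGeo

open RelGeo in
theorem mainTheorem1 {n : ℕ} (hn : 1 ≤ n) {r : WithTop ℕ∞} (hr : 3 ≤ r)
    {U : Set (E n)} {x ξ : E n → E (n + 1)}
    (hx : IsHypersurface r U x) (hξ : IsEuclideanNormalization U x ξ)
    (hK : ∀ u ∈ U, gaussCurvature x ξ u ≠ 0)
    {s : WithTop ℕ∞} (hs : 1 ≤ s) (hsr : s < r)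
    {y : E n → E (n + 1)} (hy : IsRelativeNormalization s U x y) :
    -- the decomposition of `T`
    (∀ u ∈ U, tchebychev x y u
      = support ξ y u • tchebychev x ξ u
        - (support ξ y u * ((n : ℝ) + 2)) • vectorQ ξ y u) ∧
    -- the Tchebychev vector field of the Euclidean normalization
    (∀ u ∈ U, tchebychev x ξ u
      = (1 / (2 * (n : ℝ) * gaussCurvature x ξ u))
          • beltrami (formIII ξ) (gaussCurvature x ξ) ξ u) ∧
    -- `y = q (2nQ + ξ)`, so that `2nqQ` is the tangential projection of `y`
    (∀ u ∈ U, y u = support ξ y u • ((2 * (n : ℝ)) • vectorQ ξ y u + ξ u)) ∧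
    (∀ u ∈ U, (tangentSpace x u).starProjection (y u)
      = (2 * (n : ℝ) * support ξ y u) • vectorQ ξ y u) ∧
    -- `(1/q) [2nT + (n+2)y]` equals `2n T_EUK + (n+2) ξ`
    (∀ u ∈ U, (1 / support ξ y u)
        • ((2 * (n : ℝ)) • tchebychev x y u + ((n : ℝ) + 2) • y u)
      = (2 * (n : ℝ)) • tchebychev x ξ u + ((n : ℝ) + 2) • ξ u) ∧
    -- and is the same for all relative normalizations
    (∀ (s' : WithTop ℕ∞) (y' : E n → E (n + 1)), 1 ≤ s' → s' < r →
      IsRelativeNormalization s' U x y' → ∀ u ∈ U,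
        (1 / support ξ y u) • ((2 * (n : ℝ)) • tchebychev x y u + ((n : ℝ) + 2) • y u)
          = (1 / support ξ y' u)
            • ((2 * (n : ℝ)) • tchebychev x y' u + ((n : ℝ) + 2) • y' u)) ∧
    -- `T = ∇^G(ln φ, x)`
    (∀ u ∈ U, tchebychev x y u
      = beltrami (relMetric x y) (fun w => Real.log (phi x ξ y w)) x u) ∧
    -- `T` is irrotational with respect to `G`
    (4 ≤ r → IsIrrotational (relMetric x y) U (tchebychevComp x y)) := by
  have hx3 := hx.of_le hr
  have hy1 := hy.of_le hs
  refine ⟨fun u hu => tchebychev_eq_sub hn hx3 hξ hK hy1 hu, fun u hu => ?_,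
    fun u hu => normalization_eq hn hx3 hξ (hK u hu) hy1 hu,
    fun u hu => starProjection_normalization hn hx3 hξ (hK u hu) hy1 hu,
    fun u hu => inv_support_smul_eq hn hx3 hξ hK hy1 hu, fun s' y' hs' _ hy' u hu => ?_,
    fun u hu => tchebychev_eq_beltrami hn hx3 hξ hK hy1 hu,
    fun hr4 => isIrrotational_tchebychevComp hn (hx.of_le hr4) hξ hK hy1⟩
  · rw [tchebychev_normal hn hx3 hξ hK hu,
      beltrami_formIII_normal (hx3.of_le (by norm_num)) hξ hu (hK u hu), smul_neg, ← neg_smul]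
    congr 1
    ring
  · rw [inv_support_smul_eq hn hx3 hξ hK hy1 hu,
      inv_support_smul_eq hn hx3 hξ hK (hy'.of_le hs') hu]
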